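/- Let $\mathbb{C}_+$ be the open upper half-plane and let $H^2(\mathbb{C}_+)$ be the Hardy space of analytic functions $f$ on $\mathbb{C}_+$ with $\sup_{y>0}\int_{\mathbb{R}}|f(x+iy)|^2\,dx<\infty$, a Hilbert space with inner product $\langle f,g\rangle=\int_{\mathbb{R}}f(t)\overline{g(t)}\,dt$ formed with the boundary values of $f$ and $g$. An inner function is an analytic function $\chi$ on $\mathbb{C}_+$ with $|\chi|\le 1$ on $\mathbb{C}_+$ and $|\chi(x)|=1$ for almost every $x\in\mathbb{R}$ (boundary values); its model space is $H(\chi)=H^2(\mathbb{C}_+)\ominus\chi H^2(\mathbb{C}_+)$. **Theorem.** Let $\chi$ be a non-constant inner function on $\mathbb{C}_+$ and let $\varphi:\mathbb{C}_+\to\mathbb{C}_+$ be an analytic function such that $\sup_{z\in\mathbb{C}_+}|\chi(\varphi(z))|<1$. If the composition operator $C_\varphi:H(\chi)\to H^2(\mathbb{C}_+)$, $C_\varphi f=f\circ\varphi$, is (well defined and) bounded, then it is not compact. -/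

import Mathlib

open MeasureTheory Filter Topology Complex
open scoped ENNReal

noncomputable section

namespace HalfPlane

/-- The open upper half-plane `ℂ₊`, as a subset of `ℂ`. -/
def upperHalf : Set ℂ := {z : ℂ | 0 < z.im}

/-- `F` is a function of the Hardy class `H²(ℂ₊)`: it is analytic on `ℂ₊` and
`sup_{y > 0} ∫ |F (x + i y)|² dx < ∞`. Values of `F` outside `ℂ₊` are irrelevant. -/
structure IsHardy (F : ℂ → ℂ) : Prop where
  analytic : DifferentiableOn ℂ F upperHalf
  bounded : (⨆ y : Set.Ioi (0 : ℝ), ∫⁻ x : ℝ, ‖F (x + (y : ℝ) * I)‖ₑ ^ 2) < ∞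

/-- `F` has the boundary function `f`: for almost every real `x`,
`F (x + i y) → f x` as `y → 0⁺`. -/
def HasBoundary (F : ℂ → ℂ) (f : ℝ → ℂ) : Prop :=
  ∀ᵐ x : ℝ, Tendsto (fun y : ℝ => F (x + y * I)) (𝓝[>] 0) (𝓝 (f x))

theorem IsHardy.zero : IsHardy 0 :=
  ⟨differentiableOn_const 0, by simp⟩

theorem IsHardy.smul {F : ℂ → ℂ} (hF : IsHardy F) (c : ℂ) : IsHardy (c • F) := by
  refine ⟨hF.analytic.const_smul c, ?_⟩
  refine lt_of_le_of_lt (b := ‖c‖ₑ ^ 2 *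
    ⨆ y : Set.Ioi (0 : ℝ), ∫⁻ x : ℝ, ‖F (x + (y : ℝ) * I)‖ₑ ^ 2) ?_
    (ENNReal.mul_lt_top (by simp) hF.bounded)
  refine iSup_le fun y => ?_
  calc ∫⁻ x : ℝ, ‖(c • F) (x + (y : ℝ) * I)‖ₑ ^ 2
      = ∫⁻ x : ℝ, ‖c‖ₑ ^ 2 * ‖F (x + (y : ℝ) * I)‖ₑ ^ 2 := by
        simp [enorm_mul, mul_pow]
    _ = ‖c‖ₑ ^ 2 * ∫⁻ x : ℝ, ‖F (x + (y : ℝ) * I)‖ₑ ^ 2 :=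
        lintegral_const_mul' _ _ (by simp)
    _ ≤ _ := by
        gcongr
        exact le_iSup (fun y : Set.Ioi (0 : ℝ) =>
          ∫⁻ x : ℝ, ‖F (x + (y : ℝ) * I)‖ₑ ^ 2) y

theorem measurable_line {F : ℂ → ℂ} (hF : DifferentiableOn ℂ F upperHalf) {y : ℝ}
    (hy : 0 < y) : Measurable fun x : ℝ => F (x + y * I) := by
  have h : Continuous fun x : ℝ => F (x + y * I) :=
    hF.continuousOn.comp_continuous (by fun_prop) fun x => by simpa [upperHalf] using hy
  exact h.measurable

theorem enorm_add_sq_le (a b : ℂ) : ‖a + b‖ₑ ^ 2 ≤ 2 * ‖a‖ₑ ^ 2 + 2 * ‖b‖ₑ ^ 2 := by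
  have h : ‖a + b‖₊ ^ 2 ≤ 2 * ‖a‖₊ ^ 2 + 2 * ‖b‖₊ ^ 2 := by
    have h1 : ‖a + b‖ ≤ ‖a‖ + ‖b‖ := norm_add_le a b
    have h2 : ‖a + b‖ ^ 2 ≤ 2 * ‖a‖ ^ 2 + 2 * ‖b‖ ^ 2 := by
      nlinarith [sq_nonneg (‖a‖ - ‖b‖), norm_nonneg (a + b), norm_nonneg a, norm_nonneg b]
    exact_mod_cast h2
  simp only [enorm_eq_nnnorm]
  exact_mod_cast h

theorem IsHardy.add {F G : ℂ → ℂ} (hF : IsHardy F) (hG : IsHardy G) : IsHardy (F + G) := by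
  refine ⟨hF.analytic.add hG.analytic, ?_⟩
  refine lt_of_le_of_lt (b :=
    2 * (⨆ y : Set.Ioi (0 : ℝ), ∫⁻ x : ℝ, ‖F (x + (y : ℝ) * I)‖ₑ ^ 2) +
    2 * (⨆ y : Set.Ioi (0 : ℝ), ∫⁻ x : ℝ, ‖G (x + (y : ℝ) * I)‖ₑ ^ 2)) ?_
    (ENNReal.add_lt_top.2 ⟨ENNReal.mul_lt_top (by simp) hF.bounded,
      ENNReal.mul_lt_top (by simp) hG.bounded⟩)
  refine iSup_le fun y => ?_
  have hy : 0 < (y : ℝ) := y.2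
  calc ∫⁻ x : ℝ, ‖(F + G) (x + (y : ℝ) * I)‖ₑ ^ 2
      ≤ ∫⁻ x : ℝ, (2 * ‖F (x + (y : ℝ) * I)‖ₑ ^ 2 + 2 * ‖G (x + (y : ℝ) * I)‖ₑ ^ 2) :=
        lintegral_mono fun x => enorm_add_sq_le _ _
    _ = 2 * (∫⁻ x : ℝ, ‖F (x + (y : ℝ) * I)‖ₑ ^ 2) +
          2 * ∫⁻ x : ℝ, ‖G (x + (y : ℝ) * I)‖ₑ ^ 2 := by
        rw [lintegral_add_left (((measurable_line hF.analytic hy).enorm.pow_const 2).const_mul 2),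
          lintegral_const_mul' _ _ (by simp), lintegral_const_mul' _ _ (by simp)]
    _ ≤ _ := by
        gcongr
        · exact le_iSup (fun y : Set.Ioi (0 : ℝ) =>
            ∫⁻ x : ℝ, ‖F (x + (y : ℝ) * I)‖ₑ ^ 2) y
        · exact le_iSup (fun y : Set.Ioi (0 : ℝ) =>
            ∫⁻ x : ℝ, ‖G (x + (y : ℝ) * I)‖ₑ ^ 2) y

/-- `F` is the analytic function on `ℂ₊` belonging to the element `f` of `L²(ℝ)`:
`F` is of Hardy class and has boundary function `f`. -/
def IsExtension (F : ℂ → ℂ) (f : Lp ℂ 2 (volume : Measure ℝ)) : Prop :=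
  IsHardy F ∧ HasBoundary F f

theorem IsExtension.zero : IsExtension 0 0 := by
  refine ⟨IsHardy.zero, ?_⟩
  filter_upwards [Lp.coeFn_zero ℂ 2 (volume : Measure ℝ)] with x hx
  rw [hx]
  exact tendsto_const_nhds

theorem IsExtension.add {F G : ℂ → ℂ} {f g : Lp ℂ 2 (volume : Measure ℝ)}
    (hF : IsExtension F f) (hG : IsExtension G g) : IsExtension (F + G) (f + g) := by
  refine ⟨hF.1.add hG.1, ?_⟩
  filter_upwards [hF.2, hG.2, Lp.coeFn_add f g] with x h1 h2 h3
  rw [h3]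
  exact h1.add h2

theorem IsExtension.smul {F : ℂ → ℂ} {f : Lp ℂ 2 (volume : Measure ℝ)}
    (hF : IsExtension F f) (c : ℂ) : IsExtension (c • F) (c • f) := by
  refine ⟨hF.1.smul c, ?_⟩
  filter_upwards [hF.2, Lp.coeFn_smul c f] with x h1 h2
  rw [h2]
  exact h1.const_smul c

/-- The Hardy Hilbert space `H²(ℂ₊)`. A function of Hardy class has a boundary function in
`L²(ℝ)` and is determined by it; as usual the space is identified with the space of these
boundary functions, and carries the inner product of `L²(ℝ)`, `∫ f(t) conj(g(t)) dt`. -/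
def hardySpace : Submodule ℂ (Lp ℂ 2 (volume : Measure ℝ)) where
  carrier := {f | ∃ F : ℂ → ℂ, IsExtension F f}
  zero_mem' := ⟨0, IsExtension.zero⟩
  add_mem' := fun ⟨F, hF⟩ ⟨G, hG⟩ => ⟨F + G, hF.add hG⟩
  smul_mem' := fun c _ ⟨F, hF⟩ => ⟨c • F, hF.smul c⟩

/-- `χ` is an inner function on `ℂ₊`: it is analytic on `ℂ₊`, `|χ| ≤ 1` on `ℂ₊`, and its
boundary values have modulus one at almost every point of `ℝ`. -/
structure IsInner (χ : ℂ → ℂ) : Prop where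
  analytic : DifferentiableOn ℂ χ upperHalf
  norm_le_one : ∀ z ∈ upperHalf, ‖χ z‖ ≤ 1
  boundary : ∀ᵐ x : ℝ, ∃ c : ℂ, ‖c‖ = 1 ∧
    Tendsto (fun y : ℝ => χ (x + y * I)) (𝓝[>] 0) (𝓝 c)

/-- The subspace `χ H²(ℂ₊)` of `H²(ℂ₊)`: the elements whose analytic function is `χ G`
for some `G` of Hardy class. -/
def innerMul (χ : ℂ → ℂ) : Submodule ℂ hardySpace where
  carrier := {f | ∃ G : ℂ → ℂ, IsHardy G ∧ IsExtension (χ * G) f}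
  zero_mem' := ⟨0, IsHardy.zero, by simpa using IsExtension.zero⟩
  add_mem' := fun ⟨F, hF, hF'⟩ ⟨G, hG, hG'⟩ =>
    ⟨F + G, hF.add hG, by simpa [mul_add] using hF'.add hG'⟩
  smul_mem' := fun c _ ⟨F, hF, hF'⟩ =>
    ⟨c • F, hF.smul c, by simpa [mul_smul_comm] using hF'.smul c⟩

/-- The model space `H(χ) = H²(ℂ₊) ⊖ χ H²(ℂ₊)`. -/
def modelSpace (χ : ℂ → ℂ) : Submodule ℂ hardySpace := (innerMul χ)ᗮ

/-- The bounded operator `T : H(χ) → H²(ℂ₊)` is the composition operator `C_φ`: whenever `F` is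
the analytic function of `f ∈ H(χ)`, the analytic function of `T f` is `F ∘ φ`. -/
def IsCompositionOperator (χ φ : ℂ → ℂ) (T : modelSpace χ →L[ℂ] hardySpace) : Prop :=
  ∀ (f : modelSpace χ) (F : ℂ → ℂ),
    IsExtension F ((f : hardySpace) : Lp ℂ 2 (volume : Measure ℝ)) →
      IsExtension (F ∘ φ) (T f : Lp ℂ 2 (volume : Measure ℝ))

end HalfPlane

end

noncomputable section

namespace HalfPlane

/-! The operator is tested on model kernels along the imaginary axis. Put `w n = φ(i t n)` with `t n
→ ∞`, and let `k n` be the kernel of `H(χ)` at `w n`, of norm at most `2 √(π / Im w n)`. Since `|χ ∘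
φ| ≤ δ < 1`, the value of `C_φ (k n)` at `i t n` has modulus at least `(1 - δ²) / (2 Im w n)`, so
the point evaluation bound `norm_eval_le` bounds `‖C_φ (k n)‖` from below.

Boundedness of `C_φ` then forces `t n ≤ c Im w n`, so the functions `√(t n) k n` are bounded in
norm. In the other direction Schwarz–Pick (`im_map_le`) gives `Im w n ≤ 4 t n Im φ(i)`, which keeps
the norms of their images away from `0`. The images nevertheless tend to `0` at every point, so a
norm limit of a subsequence would be both zero and nonzero.

The analytic input is the Cauchy formula `IsHardy.cauchy_boundary`. It yields the evaluation bound,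
and also the orthogonality of the model kernels to `χ H²` (`IsInner.exists_modelKernel`). -/

/-! ### Cauchy kernels on the real line. -/

theorem ofReal_sub_ne_zero {w : ℂ} (hw : w.im ≠ 0) (x : ℝ) : (x : ℂ) - w ≠ 0 := by
  intro h
  apply hw
  have := congrArg Complex.im h
  simpa using this

theorem norm_inv_sub_sq {w : ℂ} (hw : w.im ≠ 0) (x : ℝ) :
    ‖((x : ℂ) - w)⁻¹‖ ^ 2 = (w.im ^ 2)⁻¹ * (1 + ((x - w.re) / w.im) ^ 2)⁻¹ := by
  rw [norm_inv, inv_pow, ← Complex.normSq_eq_norm_sq, Complex.normSq_apply, ← mul_inv]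
  congr 1
  simp
  field_simp
  ring

theorem continuous_inv_sub {w : ℂ} (hw : w.im ≠ 0) :
    Continuous fun x : ℝ => ((x : ℂ) - w)⁻¹ :=
  Continuous.inv₀ (by fun_prop) (ofReal_sub_ne_zero hw)

theorem integrable_norm_inv_sub_sq {w : ℂ} (hw : w.im ≠ 0) :
    Integrable fun x : ℝ => ‖((x : ℂ) - w)⁻¹‖ ^ 2 := by
  simp_rw [norm_inv_sub_sq hw]
  exact ((integrable_inv_one_add_sq.comp_div hw).comp_sub_right w.re).const_mul _

theorem integral_norm_inv_sub_sq {w : ℂ} (hw : w.im ≠ 0) :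
    ∫ x : ℝ, ‖((x : ℂ) - w)⁻¹‖ ^ 2 = Real.pi / |w.im| := by
  simp_rw [norm_inv_sub_sq hw]
  rw [integral_const_mul,
    integral_sub_right_eq_self (fun x : ℝ => (1 + (x / w.im) ^ 2)⁻¹) w.re,
    Measure.integral_comp_div (fun x : ℝ => (1 + x ^ 2)⁻¹), integral_univ_inv_one_add_sq,
    smul_eq_mul, ← sq_abs w.im]
  have := abs_ne_zero.2 hw
  field_simp

theorem memLp_inv_sub {w : ℂ} (hw : w.im ≠ 0) :
    MemLp (fun x : ℝ => ((x : ℂ) - w)⁻¹) 2 volume :=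
  (memLp_two_iff_integrable_sq_norm (continuous_inv_sub hw).aestronglyMeasurable).2
    (integrable_norm_inv_sub_sq hw)

theorem lintegral_enorm_inv_sub_sq {w : ℂ} (hw : w.im ≠ 0) :
    ∫⁻ x : ℝ, ‖((x : ℂ) - w)⁻¹‖ₑ ^ 2 = ENNReal.ofReal (Real.pi / |w.im|) := by
  rw [← integral_norm_inv_sub_sq hw, ofReal_integral_eq_lintegral_ofReal
    (integrable_norm_inv_sub_sq hw) (ae_of_all _ fun x => by positivity)]
  refine lintegral_congr fun x => ?_
  rw [ENNReal.ofReal_pow (norm_nonneg _), ofReal_norm]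

/-- The pole lies below the real axis, so the integral over the line at height `y` is `π / (y - Im
w)`, at most `π / |Im w|`. -/
theorem isHardy_inv_sub {w : ℂ} (hw : w.im < 0) : IsHardy fun z => (z - w)⁻¹ := by
  refine ⟨?_, ?_⟩
  · refine DifferentiableOn.inv (by fun_prop) fun z hz h => ?_
    have := congrArg Complex.im h
    simp [upperHalf] at this hz
    linarith
  · refine lt_of_le_of_lt (b := ENNReal.ofReal (Real.pi / |w.im|)) (iSup_le fun y => ?_)
      ENNReal.ofReal_lt_top
    have hy : 0 < (y : ℝ) := y.2
    have him : (w - (y : ℝ) * I).im = w.im - y := by simp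
    have h := lintegral_enorm_inv_sub_sq (w := w - (y : ℝ) * I) (by rw [him]; linarith)
    have h2 : ∀ x : ℝ, (x : ℂ) - (w - (y : ℝ) * I) = x + (y : ℝ) * I - w := fun x => by ring
    simp_rw [h2] at h
    rw [h, him]
    apply ENNReal.ofReal_le_ofReal
    rw [abs_of_neg hw, abs_of_neg (by linarith)]
    have := Real.pi_pos
    gcongr
    · linarith
    · linarith

/-! ### Horizontal slices of Hardy functions and weak convergence in `L²`. -/

/-- The squared Hardy norm of `F`. -/
def hardyBound (F : ℂ → ℂ) : ℝ≥0∞ :=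
  ⨆ y : Set.Ioi (0 : ℝ), ∫⁻ x : ℝ, ‖F (x + (y : ℝ) * I)‖ₑ ^ 2

theorem lintegral_line_le (F : ℂ → ℂ) {y : ℝ} (hy : 0 < y) :
    ∫⁻ x : ℝ, ‖F (x + y * I)‖ₑ ^ 2 ≤ hardyBound F :=
  le_iSup (fun y : Set.Ioi (0 : ℝ) => ∫⁻ x : ℝ, ‖F (x + (y : ℝ) * I)‖ₑ ^ 2) ⟨y, hy⟩

theorem memLp_two_of_lintegral_lt_top {f : ℝ → ℂ} (hf : AEStronglyMeasurable f volume)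
    (h : ∫⁻ x : ℝ, ‖f x‖ₑ ^ 2 < ∞) : MemLp f 2 volume := by
  refine ⟨hf, ?_⟩
  rw [eLpNorm_lt_top_iff_lintegral_rpow_enorm_lt_top (by simp) (by simp)]
  simpa using h

theorem IsHardy.memLp_line {F : ℂ → ℂ} (hF : IsHardy F) {y : ℝ} (hy : 0 < y) :
    MemLp (fun x : ℝ => F (x + y * I)) 2 volume :=
  memLp_two_of_lintegral_lt_top (measurable_line hF.analytic hy).aestronglyMeasurable
    ((lintegral_line_le F hy).trans_lt hF.bounded)

/-- The Cauchy-Schwarz inequality in `L²(ℝ)`, with extended norms. -/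
theorem enorm_integral_mul_sq_le {f g : ℝ → ℂ} (hf : AEStronglyMeasurable f volume)
    (hg : AEStronglyMeasurable g volume) :
    ‖∫ x : ℝ, f x * g x‖ₑ ^ 2 ≤ (∫⁻ x : ℝ, ‖f x‖ₑ ^ 2) * ∫⁻ x : ℝ, ‖g x‖ₑ ^ 2 := by
  have h1 : ‖∫ x : ℝ, f x * g x‖ₑ ≤ ∫⁻ x : ℝ, ‖f x‖ₑ * ‖g x‖ₑ := by
    refine (enorm_integral_le_lintegral_enorm _).trans_eq ?_
    simp [enorm_mul]
  have h2 := ENNReal.lintegral_mul_le_Lp_mul_Lq (volume : Measure ℝ)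
    (Real.HolderConjugate.two_two) hf.enorm hg.enorm
  have h3 := pow_le_pow_left' (h1.trans h2) 2
  refine h3.trans_eq ?_
  rw [mul_pow]
  simp only [← ENNReal.rpow_natCast, ← ENNReal.rpow_mul]
  norm_num

/-- A sequence bounded in `L²` and convergent almost everywhere converges weakly. -/
theorem tendsto_integral_mul_of_bounded {u : ℕ → ℝ → ℂ} {v k : ℝ → ℂ} {M : ℝ≥0∞}
    (hu : ∀ n, AEStronglyMeasurable (u n) volume) (hM : M < ∞)
    (huM : ∀ n, ∫⁻ x, ‖u n x‖ₑ ^ 2 ≤ M) (hv : MemLp v 2 volume) (hk : MemLp k 2 volume)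
    (huv : ∀ᵐ x : ℝ, Tendsto (fun n => u n x) atTop (𝓝 (v x))) :
    Tendsto (fun n => ∫ x, u n x * k x) atTop (𝓝 (∫ x, v x * k x)) := by
  have hu2 : ∀ n, MemLp (u n) 2 volume := fun n =>
    memLp_two_of_lintegral_lt_top (hu n) ((huM n).trans_lt hM)
  have hsq : ∀ n, Integrable fun x => ‖u n x - v x‖ ^ 2 := fun n =>
    (memLp_two_iff_integrable_sq_norm ((hu n).sub hv.1)).1 ((hu2 n).sub hv)
  have hksq : Integrable fun x => ‖k x‖ ^ 2 := (memLp_two_iff_integrable_sq_norm hk.1).1 hk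
  have hvsq : Integrable fun x => ‖v x‖ ^ 2 := (memLp_two_iff_integrable_sq_norm hv.1).1 hv
  have husq : ∀ n, Integrable fun x => ‖u n x‖ ^ 2 := fun n =>
    (memLp_two_iff_integrable_sq_norm (hu n)).1 (hu2 n)
  have hub : ∀ n, ∫ x, ‖u n x‖ ^ 2 ≤ M.toReal := fun n => by
    rw [integral_eq_lintegral_of_nonneg_ae (ae_of_all _ fun x => by positivity) (husq n).1]
    refine ENNReal.toReal_mono hM.ne ((huM n).trans_eq' ?_)
    refine lintegral_congr fun x => ?_
    rw [ENNReal.ofReal_pow (norm_nonneg _), ofReal_norm]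
  set B : ℝ := 2 * M.toReal + 2 * ∫ x, ‖v x‖ ^ 2 with hB
  have hB0 : 0 ≤ B := by positivity
  have hbound : ∀ n, ∫ x, ‖u n x - v x‖ ^ 2 ≤ B := fun n => by
    calc ∫ x, ‖u n x - v x‖ ^ 2 ≤ ∫ x, (2 * ‖u n x‖ ^ 2 + 2 * ‖v x‖ ^ 2) := by
          refine integral_mono (hsq n) (((husq n).const_mul 2).add (hvsq.const_mul 2)) fun x => ?_
          have := norm_sub_le (u n x) (v x)
          simp only
          nlinarith [sq_nonneg (‖u n x‖ - ‖v x‖), norm_nonneg (u n x - v x)]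
      _ = 2 * (∫ x, ‖u n x‖ ^ 2) + 2 * ∫ x, ‖v x‖ ^ 2 := by
          rw [integral_add ((husq n).const_mul 2) (hvsq.const_mul 2), integral_const_mul,
            integral_const_mul]
      _ ≤ B := by linarith [hub n]
  rw [tendsto_iff_norm_sub_tendsto_zero, Metric.tendsto_atTop]
  intro ε hε
  obtain ⟨N, hN⟩ := exists_nat_gt (B / (ε / 2))
  have hN0 : (0 : ℝ) < N := lt_of_le_of_lt (by positivity) hN
  have hBN : B / N < ε / 2 := by
    rw [div_lt_iff₀ (by positivity)] at hN ⊢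
    linarith
  -- Truncation at `N |k|²` makes dominated convergence available. Where the truncation is active,
  -- `|k| ≤ |u n - v| / N`, so the product is at most `|u n - v|² / N`, whose integral is at most `B
  -- / N < ε / 2`.
  let g : ℕ → ℝ → ℝ := fun n x => min (‖u n x - v x‖ * ‖k x‖) (N * ‖k x‖ ^ 2)
  have hgm : ∀ n, AEStronglyMeasurable (g n) volume := fun n =>
    (((hu n).sub hv.1).norm.mul hk.1.norm).inf (hksq.const_mul _).1
  have hgle : ∀ n x, ‖g n x‖ ≤ N * ‖k x‖ ^ 2 := fun n x => by
    rw [Real.norm_of_nonneg (le_min (by positivity) (by positivity))]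
    exact min_le_right _ _
  have hg : Tendsto (fun n => ∫ x, g n x) atTop (𝓝 (∫ _ : ℝ, (0 : ℝ))) := by
    refine tendsto_integral_of_dominated_convergence (fun x => N * ‖k x‖ ^ 2) hgm
      (hksq.const_mul _) (fun n => ae_of_all _ (hgle n)) ?_
    filter_upwards [huv] with x hx
    have h1 : Tendsto (fun n => ‖u n x - v x‖ * ‖k x‖) atTop (𝓝 0) := by
      simpa using (tendsto_iff_norm_sub_tendsto_zero.1 hx).mul_const ‖k x‖
    have h2 := h1.min (tendsto_const_nhds (x := (N : ℝ) * ‖k x‖ ^ 2))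
    rwa [min_eq_left (by positivity)] at h2
  rw [integral_zero, Metric.tendsto_atTop] at hg
  obtain ⟨n₀, hn₀⟩ := hg (ε / 2) (by positivity)
  refine ⟨n₀, fun n hn => ?_⟩
  have hgi : Integrable (g n) := (hksq.const_mul _).mono' (hgm n) (ae_of_all _ (hgle n))
  have h1 : ∫ x, u n x * k x - v x * k x = (∫ x, u n x * k x) - ∫ x, v x * k x :=
    integral_sub ((hu2 n).integrable_mul hk) (hv.integrable_mul hk)
  rw [← h1, Real.dist_eq, sub_zero, abs_norm]
  have hpt : ∀ x, ‖u n x * k x - v x * k x‖ ≤ g n x + (N : ℝ)⁻¹ * ‖u n x - v x‖ ^ 2 := by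
    intro x
    rw [← sub_mul, norm_mul]
    rcases le_total (‖u n x - v x‖ * ‖k x‖) (N * ‖k x‖ ^ 2) with h | h
    · have : g n x = ‖u n x - v x‖ * ‖k x‖ := min_eq_left h
      rw [this]
      have : 0 ≤ (N : ℝ)⁻¹ * ‖u n x - v x‖ ^ 2 := by positivity
      linarith
    · have hg0 : 0 ≤ g n x := le_min (by positivity) (by positivity)
      have hk0 := norm_nonneg (k x)
      have : ‖k x‖ ≤ (N : ℝ)⁻¹ * ‖u n x - v x‖ := by
        rcases hk0.eq_or_lt with h0 | h0
        · rw [← h0]; positivity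
        · rw [inv_mul_eq_div, le_div_iff₀ hN0]
          refine le_of_mul_le_mul_right ?_ h0
          linarith
      have := mul_le_mul_of_nonneg_left this (norm_nonneg (u n x - v x))
      linarith
  calc ‖∫ x, u n x * k x - v x * k x‖
      ≤ ∫ x, (g n x + (N : ℝ)⁻¹ * ‖u n x - v x‖ ^ 2) :=
        norm_integral_le_of_norm_le (hgi.add ((hsq n).const_mul _)) (ae_of_all _ hpt)
    _ = (∫ x, g n x) + (N : ℝ)⁻¹ * ∫ x, ‖u n x - v x‖ ^ 2 := by
        rw [integral_add hgi ((hsq n).const_mul _), integral_const_mul]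
    _ < ε := by
        have h2 := hn₀ n hn
        rw [Real.dist_eq, sub_zero] at h2
        have h3 := (le_abs_self _).trans_lt h2
        have h4 : (N : ℝ)⁻¹ * ∫ x, ‖u n x - v x‖ ^ 2 ≤ B / N := by
          rw [inv_mul_eq_div]
          gcongr
          exact hbound n
        linarith

/-! ### The Cauchy formula in the Hardy class. -/

theorem isOpen_upperHalf : IsOpen upperHalf :=
  isOpen_lt continuous_const Complex.continuous_im

theorem lineInv_eq (w : ℂ) (x y : ℝ) :
    ((x : ℂ) + y * I - w)⁻¹ = ((x : ℂ) - (w - y * I))⁻¹ := by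
  congr 1; ring

theorem IsHardy.integrable_line_mul_inv {Q : ℂ → ℂ} (hQ : IsHardy Q) {w : ℂ} {y : ℝ} (hy : 0 < y)
    (hyw : y ≠ w.im) : Integrable fun x : ℝ => Q (x + y * I) * ((x : ℂ) + y * I - w)⁻¹ := by
  simp_rw [lineInv_eq]
  refine (hQ.memLp_line hy).integrable_mul (memLp_inv_sub ?_)
  simpa [sub_eq_zero] using hyw.symm

theorem enorm_integral_line_mul_inv_sq_le {Q : ℂ → ℂ} (hQ : IsHardy Q) {w : ℂ} {y : ℝ}
    (hy : 0 < y) (hyw : w.im < y) :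
    ‖∫ x : ℝ, Q (x + y * I) * ((x : ℂ) + y * I - w)⁻¹‖ₑ ^ 2 ≤
      hardyBound Q * ENNReal.ofReal (Real.pi / (y - w.im)) := by
  have him : (w - (y : ℂ) * I).im = w.im - y := by simp
  have hne : (w - (y : ℂ) * I).im ≠ 0 := by rw [him]; linarith
  simp_rw [lineInv_eq]
  refine (enorm_integral_mul_sq_le (measurable_line hQ.analytic hy).aestronglyMeasurable
    (continuous_inv_sub hne).aestronglyMeasurable).trans ?_
  rw [lintegral_enorm_inv_sub_sq hne, him, abs_of_neg (by linarith), neg_sub]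
  gcongr
  exact lintegral_line_le Q hy

theorem IsHardy.integrable_strip_sq {Q : ℂ → ℂ} (hQ : IsHardy Q) {a b : ℝ} (ha : 0 < a) :
    Integrable (fun p : ℝ × ℝ => ‖Q (p.1 + p.2 * I)‖ ^ 2)
      ((volume : Measure ℝ).prod (volume.restrict (Set.Ioc a b))) := by
  have hms : MeasurableSet (Set.univ ×ˢ Set.Ioc a b : Set (ℝ × ℝ)) :=
    MeasurableSet.univ.prod measurableSet_Ioc
  have hcont : ContinuousOn (fun p : ℝ × ℝ => ‖Q (p.1 + p.2 * I)‖ ^ 2)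
      (Set.univ ×ˢ Set.Ioc a b) := by
    refine (ContinuousOn.comp hQ.analytic.continuousOn (by fun_prop) ?_).norm.pow 2
    rintro ⟨x, y⟩ ⟨-, hy⟩
    simpa [upperHalf] using ha.trans hy.1
  have hm := hcont.aestronglyMeasurable (μ := volume) hms
  have hrestr : (volume : Measure (ℝ × ℝ)).restrict (Set.univ ×ˢ Set.Ioc a b) =
      (volume : Measure ℝ).prod (volume.restrict (Set.Ioc a b)) := by
    rw [Measure.volume_eq_prod, ← Measure.prod_restrict, Measure.restrict_univ]
  rw [hrestr] at hm
  refine ⟨hm, ?_⟩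
  rw [hasFiniteIntegral_iff_enorm, lintegral_prod_symm _ hm.enorm]
  refine lt_of_le_of_lt (b := ∫⁻ _ in Set.Ioc a b, hardyBound Q) ?_ ?_
  · refine setLIntegral_mono measurable_const fun y hy => ?_
    refine le_trans (le_of_eq (lintegral_congr fun x => ?_)) (lintegral_line_le Q (ha.trans hy.1))
    simp [enorm_pow]
  · rw [setLIntegral_const]
    exact ENNReal.mul_lt_top hQ.bounded (by simp)

/-- By `|Q| |k| ≤ |Q|² + |k|²`, the integrand is dominated on the strip by `|Q|²`, integrable by the
Hardy bound, plus a multiple of `1 / (1 + (x - Re w)²)`; Fubini does the rest. This controls the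
vertical sides of large rectangles without any pointwise decay of `Q`. -/
theorem IsHardy.integrableOn_vertical {Q : ℂ → ℂ} (hQ : IsHardy Q) (w : ℂ) {a b : ℝ} (ha : 0 < a)
    (hab : a ≤ b) :
    IntegrableOn (fun x : ℝ => ∫ y in a..b, Q (x + y * I) * ((x : ℂ) + y * I - w)⁻¹)
      {x : ℝ | 1 < |x - w.re|} := by
  have hS : MeasurableSet {x : ℝ | 1 < |x - w.re|} := by measurability
  have hms : MeasurableSet ({x : ℝ | 1 < |x - w.re|} ×ˢ Set.Ioc a b : Set (ℝ × ℝ)) :=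
    hS.prod measurableSet_Ioc
  have hne : ∀ {x y : ℝ}, 1 < |x - w.re| → (x : ℂ) + y * I - w ≠ 0 := by
    intro x y hx h
    have := congrArg Complex.re h
    simp at this
    rw [this] at hx
    norm_num at hx
  have hcont : ContinuousOn (fun p : ℝ × ℝ => Q (p.1 + p.2 * I) * ((p.1 : ℂ) + p.2 * I - w)⁻¹)
      ({x : ℝ | 1 < |x - w.re|} ×ˢ Set.Ioc a b) := by
    refine (ContinuousOn.comp hQ.analytic.continuousOn (by fun_prop) ?_).mul
      (ContinuousOn.inv₀ (by fun_prop) ?_)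
    · rintro ⟨x, y⟩ ⟨-, hy⟩
      simpa [upperHalf] using ha.trans hy.1
    · rintro ⟨x, y⟩ ⟨hx, -⟩
      exact hne hx
  have hm := hcont.aestronglyMeasurable (μ := volume) hms
  have hrestr : (volume : Measure (ℝ × ℝ)).restrict ({x : ℝ | 1 < |x - w.re|} ×ˢ Set.Ioc a b) =
      ((volume : Measure ℝ).restrict {x : ℝ | 1 < |x - w.re|}).prod
        (volume.restrict (Set.Ioc a b)) := by
    rw [Measure.volume_eq_prod, ← Measure.prod_restrict]
  have hdom : Integrable (fun p : ℝ × ℝ => ‖Q (p.1 + p.2 * I)‖ ^ 2 +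
      2 * (1 + (p.1 - w.re) ^ 2)⁻¹) (volume.restrict ({x : ℝ | 1 < |x - w.re|} ×ˢ Set.Ioc a b)) := by
    rw [hrestr]
    refine ((hQ.integrable_strip_sq (b := b) ha).mono_measure ?_).add ?_
    · rw [Measure.restrict_prod_eq_prod_univ]
      exact Measure.restrict_le_self
    · exact Integrable.comp_fst (((integrable_inv_one_add_sq.comp_sub_right w.re).const_mul
        2).integrableOn (s := {x : ℝ | 1 < |x - w.re|})) _
  have hint : Integrable (fun p : ℝ × ℝ => Q (p.1 + p.2 * I) * ((p.1 : ℂ) + p.2 * I - w)⁻¹)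
      (volume.restrict ({x : ℝ | 1 < |x - w.re|} ×ˢ Set.Ioc a b)) := by
    refine hdom.mono' hm ?_
    filter_upwards [ae_restrict_mem hms] with p hp
    have hx : 1 < |p.1 - w.re| := hp.1
    have h1 : |p.1 - w.re| ≤ ‖(p.1 : ℂ) + p.2 * I - w‖ := by
      refine le_trans (le_of_eq ?_) (Complex.abs_re_le_norm _)
      simp
    have h2 : ‖((p.1 : ℂ) + p.2 * I - w)⁻¹‖ ^ 2 ≤ 2 * (1 + (p.1 - w.re) ^ 2)⁻¹ := by
      rw [norm_inv, inv_pow, inv_eq_one_div, ← div_eq_mul_inv, div_le_div_iff₀ (by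
        have := hx.trans_le h1; positivity) (by positivity), ← sq_abs (p.1 - w.re)]
      have := abs_nonneg (p.1 - w.re)
      nlinarith
    rw [norm_mul]
    nlinarith [sq_nonneg (‖Q (p.1 + p.2 * I)‖ - ‖((p.1 : ℂ) + p.2 * I - w)⁻¹‖),
      norm_nonneg (Q (p.1 + p.2 * I)), norm_nonneg ((p.1 : ℂ) + p.2 * I - w)⁻¹]
  rw [hrestr] at hint
  simp_rw [intervalIntegral.integral_of_le hab]
  exact hint.integral_prod_left

/-- Because `Q w = 0`, the quotient `Q z / (z - w)` extends holomorphically across `w` as `dslope Q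
w`, and Cauchy's theorem applies to rectangles containing `w`. -/
theorem IsHardy.integral_line_eq {Q : ℂ → ℂ} (hQ : IsHardy Q) {w : ℂ} (hQw : Q w = 0) {a b : ℝ}
    (ha : 0 < a) (haw : a < w.im) (hwb : w.im < b) :
    ∫ x : ℝ, Q (x + a * I) * ((x : ℂ) + a * I - w)⁻¹ =
      ∫ x : ℝ, Q (x + b * I) * ((x : ℂ) + b * I - w)⁻¹ := by
  have hw : w ∈ upperHalf := ha.trans haw
  have hH : ∀ z, dslope Q w z = if z = w then deriv Q w else Q z * (z - w)⁻¹ := by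
    intro z
    split_ifs with h
    · rw [h, dslope_same]
    · rw [dslope_of_ne _ h, slope_def_module, hQw, sub_zero, smul_eq_mul, mul_comm]
  have hd : DifferentiableOn ℂ (dslope Q w) upperHalf :=
    (differentiableOn_dslope (isOpen_upperHalf.mem_nhds hw)).2 hQ.analytic
  have hne : ∀ {x y : ℝ}, y ≠ w.im → (x : ℂ) + y * I ≠ w := by
    intro x y h h'
    apply h
    rw [← h']; simp
  have hne' : ∀ {x y : ℝ}, x ≠ w.re → (x : ℂ) + y * I ≠ w := by
    intro x y h h'
    apply h
    rw [← h']; simp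
  set e : ℝ → ℂ := fun x => ∫ y in a..b, Q (x + y * I) * ((x : ℂ) + y * I - w)⁻¹ with he
  have hrect : ∀ R : ℝ, |w.re| < R →
      (∫ x : ℝ in -R..R, Q (x + a * I) * ((x : ℂ) + a * I - w)⁻¹) -
      (∫ x : ℝ in -R..R, Q (x + b * I) * ((x : ℂ) + b * I - w)⁻¹) = I * (e (-R) - e R) := by
    intro R hR
    have hR1 : R ≠ w.re := fun h => by
      rw [h] at hR; exact absurd (le_abs_self w.re) (not_le.2 hR)
    have hR2 : -R ≠ w.re := fun h => by
      rw [← h, abs_neg] at hR; exact absurd (le_abs_self R) (not_le.2 hR)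
    have h := integral_boundary_rect_eq_zero_of_differentiableOn (dslope Q w)
      ⟨-R, a⟩ ⟨R, b⟩ (hd.mono ?_)
    · simp only [hH, hne haw.ne, hne hwb.ne', if_false, smul_eq_mul, hne' hR1] at h
      have h3 : ∀ y : ℝ, ((-R : ℝ) : ℂ) + y * I ≠ w := fun y => hne' hR2
      simp only [h3, if_false] at h
      simp only [he]
      linear_combination h
    · rintro z ⟨-, hz⟩
      have : z.im ∈ Set.uIcc a b := hz
      rw [Set.uIcc_of_le (by linarith)] at this
      exact ha.trans_le this.1
  have hlim : Tendsto (fun R : ℝ => I * (e (-R) - e R)) atTop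
      (𝓝 ((∫ x : ℝ, Q (x + a * I) * ((x : ℂ) + a * I - w)⁻¹) -
        ∫ x : ℝ, Q (x + b * I) * ((x : ℂ) + b * I - w)⁻¹)) := by
    have h1 := intervalIntegral_tendsto_integral
      (hQ.integrable_line_mul_inv (w := w) ha haw.ne) tendsto_neg_atTop_atBot tendsto_id
    have h2 := intervalIntegral_tendsto_integral
      (hQ.integrable_line_mul_inv (w := w) (y := b) (by linarith) hwb.ne')
      tendsto_neg_atTop_atBot tendsto_id
    refine (h1.sub h2).congr' ?_
    filter_upwards [eventually_gt_atTop |w.re|] with R hR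
    exact hrect R hR
  have hint := hQ.integrableOn_vertical w ha (by linarith : a ≤ b)
  have hneg : IntegrableOn (fun x => e (-x)) {x : ℝ | 1 < |-x - w.re|} :=
    ((Measure.measurePreserving_neg (volume : Measure ℝ)).integrableOn_comp_preimage
      (Homeomorph.neg ℝ).measurableEmbedding).2 hint
  have hI : IntegrableOn (fun R : ℝ => I * (e (-R) - e R)) (Set.Ioi (1 + |w.re|)) := by
    refine Integrable.const_mul (Integrable.sub (hneg.mono_set ?_) (hint.mono_set ?_)) I
    · intro x (hx : 1 + |w.re| < x)
      rw [Set.mem_ofPred_eq, lt_abs]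
      right
      linarith [neg_abs_le w.re]
    · intro x (hx : 1 + |w.re| < x)
      rw [Set.mem_ofPred_eq, lt_abs]
      left
      linarith [le_abs_self w.re]
  -- The vertical contribution has a limit as `R → ∞` and is integrable in `R` near infinity, so the
  -- limit is `0`.
  refine sub_eq_zero.1 (IntegrableAtFilter.eq_zero_of_tendsto (μ := volume)
    ⟨_, Ioi_mem_atTop _, hI⟩ ?_ hlim)
  intro s hs
  obtain ⟨c, hc⟩ := mem_atTop_sets.1 hs
  exact measure_mono_top (fun x hx => hc x hx) Real.volume_Ici

/-- The line can be moved up to any height `b > Im w`, where Cauchy–Schwarz bounds the squared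
integral by a multiple of `1 / (b - Im w)`. -/
theorem IsHardy.integral_line_eq_zero {Q : ℂ → ℂ} (hQ : IsHardy Q) {w : ℂ} (hQw : Q w = 0)
    {a : ℝ} (ha : 0 < a) (haw : a < w.im) :
    ∫ x : ℝ, Q (x + a * I) * ((x : ℂ) + a * I - w)⁻¹ = 0 := by
  set J := ∫ x : ℝ, Q (x + a * I) * ((x : ℂ) + a * I - w)⁻¹ with hJ
  have hle : ∀ b : ℝ, w.im < b →
      ‖J‖ₑ ^ 2 ≤ hardyBound Q * ENNReal.ofReal (Real.pi / (b - w.im)) := fun b hb => by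
    rw [hJ, hQ.integral_line_eq hQw ha haw hb]
    exact enorm_integral_line_mul_inv_sq_le hQ (by linarith) hb
  have hlim : Tendsto (fun b : ℝ => hardyBound Q * ENNReal.ofReal (Real.pi / (b - w.im))) atTop
      (𝓝 0) := by
    have h1 : Tendsto (fun b : ℝ => Real.pi / (b - w.im)) atTop (𝓝 0) :=
      (tendsto_atTop_add_const_right atTop (-w.im) tendsto_id).const_div_atTop _
    have h2 := ENNReal.Tendsto.const_mul (a := hardyBound Q) (ENNReal.tendsto_ofReal h1)
      (Or.inr hQ.bounded.ne)
    simpa using h2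
  have h0 : ‖J‖ₑ ^ 2 ≤ 0 := ge_of_tendsto hlim
    ((eventually_gt_atTop w.im).mono fun b hb => hle b hb)
  simpa using h0

/-- The Cauchy formula for functions of Hardy class on a horizontal line. -/
theorem IsHardy.cauchy_line {F : ℂ → ℂ} (hF : IsHardy F) {w : ℂ} {a : ℝ} (ha : 0 < a)
    (haw : 2 * a < w.im) :
    ∫ x : ℝ, F (x + a * I) * ((x : ℂ) + a * I - w)⁻¹ = 2 * Real.pi * I * F w := by
  set v : ℂ := starRingEnd ℂ w + 2 * a * I with hv
  have hvim : v.im = 2 * a - w.im := by simp [hv]; ring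
  have hwv : w - v = 2 * (w.im - a) * I := by
    apply Complex.ext <;> simp [hv]
    ring
  have hvH : IsHardy fun z => (z - v)⁻¹ := isHardy_inv_sub (by rw [hvim]; linarith)
  have hpos : 0 < w.im - a := by linarith
  have hwv0 : w - v ≠ 0 := by
    rw [hwv]
    refine mul_ne_zero (mul_ne_zero two_ne_zero ?_) I_ne_zero
    exact_mod_cast hpos.ne'
  -- With this `c`, the Hardy function `F - c / (z - v)` vanishes at `w`.
  set c : ℂ := F w * (w - v) with hc
  have hQ : IsHardy (F + (-c) • fun z => (z - v)⁻¹) := hF.add (hvH.smul (-c))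
  have h0 := hQ.integral_line_eq_zero (w := w) (a := a) (by simp [hc, hwv0]) ha (by linarith)
  have hker : ∀ x : ℝ, ((x : ℂ) + a * I - v)⁻¹ * ((x : ℂ) + a * I - w)⁻¹ =
      ((‖((x : ℂ) - (w - a * I))⁻¹‖ ^ 2 : ℝ) : ℂ) := by
    intro x
    have h1 : (x : ℂ) + a * I - v = starRingEnd ℂ ((x : ℂ) - (w - a * I)) := by
      simp [hv]; ring
    rw [lineInv_eq w, h1, ← map_inv₀, Complex.conj_mul']
    push_cast
    rfl
  have hint2 : Integrable fun x : ℝ => ((x : ℂ) + a * I - v)⁻¹ * ((x : ℂ) + a * I - w)⁻¹ :=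
    hvH.integrable_line_mul_inv ha (by linarith)
  have hint2v : ∫ x : ℝ, ((x : ℂ) + a * I - v)⁻¹ * ((x : ℂ) + a * I - w)⁻¹ =
      (Real.pi / (w.im - a) : ℝ) := by
    have him : (w - a * I).im = w.im - a := by simp
    simp_rw [hker]
    rw [integral_complex_ofReal, integral_norm_inv_sub_sq (by rw [him]; exact hpos.ne'), him,
      abs_of_pos hpos]
  have hsplit : ∀ x : ℝ, (F + (-c) • fun z => (z - v)⁻¹) (x + a * I) * ((x : ℂ) + a * I - w)⁻¹ =
      F (x + a * I) * ((x : ℂ) + a * I - w)⁻¹ -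
        c * (((x : ℂ) + a * I - v)⁻¹ * ((x : ℂ) + a * I - w)⁻¹) := fun x => by
    simp; ring
  simp_rw [hsplit] at h0
  rw [integral_sub (hF.integrable_line_mul_inv ha (by linarith)) (hint2.const_mul c),
    integral_const_mul, hint2v, sub_eq_zero] at h0
  rw [h0, hc, hwv]
  have : ((w.im - a : ℝ) : ℂ) ≠ 0 := by exact_mod_cast hpos.ne'
  push_cast at this ⊢
  field_simp

/-- The Cauchy formula for functions of Hardy class in terms of their boundary function. -/
theorem IsHardy.cauchy_boundary {F : ℂ → ℂ} (hF : IsHardy F) {f : ℝ → ℂ} (hf : MemLp f 2 volume)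
    (hFf : HasBoundary F f) {w : ℂ} (hw : w ∈ upperHalf) :
    ∫ x : ℝ, f x * ((x : ℂ) - w)⁻¹ = 2 * Real.pi * I * F w := by
  have hw' : 0 < w.im := hw
  set a : ℕ → ℝ := fun n => w.im / 3 * (1 / ((n : ℝ) + 1)) with ha
  have ha0 : ∀ n, 0 < a n := fun n => by simp only [ha]; positivity
  have haw : ∀ n, 2 * a n < w.im := fun n => by
    have : 1 / ((n : ℝ) + 1) ≤ 1 := by
      rw [div_le_one (by positivity)]
      linarith [Nat.cast_nonneg (α := ℝ) n]
    simp only [ha]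
    nlinarith
  have hat : Tendsto a atTop (𝓝 0) := by
    simpa [ha] using (tendsto_one_div_add_atTop_nhds_zero_nat (𝕜 := ℝ)).const_mul (w.im / 3)
  have hat' : Tendsto a atTop (𝓝[>] 0) :=
    tendsto_nhdsWithin_iff.2 ⟨hat, Eventually.of_forall ha0⟩
  have hane : ∀ n (x : ℝ), (x : ℂ) + a n * I - w ≠ 0 := fun n x h => by
    have := congrArg Complex.im h
    simp at this
    linarith [haw n, ha0 n]
  -- The extra ratio replaces the moving kernel `1 / (x + i a n - w)` by the fixed `1 / (x - w)`; it
  -- is bounded by `2` and tends to `1`, so weak convergence applies to `u`.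
  let u : ℕ → ℝ → ℂ := fun n x => F (x + a n * I) * (((x : ℂ) - w) * ((x : ℂ) + a n * I - w)⁻¹)
  have hratio : ∀ n (x : ℝ), ‖((x : ℂ) - w) * ((x : ℂ) + a n * I - w)⁻¹‖ ≤ 2 := fun n x => by
    have h1 : ‖(x : ℂ) - w‖ ≤ ‖(x : ℂ) + a n * I - w‖ + a n := by
      have := norm_sub_le ((x : ℂ) + a n * I - w) (a n * I)
      have h2 : (x : ℂ) + a n * I - w - a n * I = x - w := by ring
      rw [h2] at this
      simpa [abs_of_pos (ha0 n)] using this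
    have h2 : w.im - a n ≤ ‖(x : ℂ) + a n * I - w‖ := by
      have := Complex.abs_im_le_norm ((x : ℂ) + a n * I - w)
      simp at this
      rw [abs_sub_comm] at this
      exact (le_abs_self _).trans this
    rw [norm_mul, norm_inv, ← div_eq_mul_inv, div_le_iff₀ (norm_pos_iff.2 (hane n x))]
    linarith [haw n]
  have hum : ∀ n, AEStronglyMeasurable (u n) volume := fun n => by
    refine ((measurable_line hF.analytic (ha0 n)).mul ?_).aestronglyMeasurable
    exact (Continuous.mul (by fun_prop) (Continuous.inv₀ (by fun_prop) (hane n))).measurable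
  have hub : ∀ n, ∫⁻ x, ‖u n x‖ₑ ^ 2 ≤ 4 * hardyBound F := fun n => by
    calc ∫⁻ x, ‖u n x‖ₑ ^ 2 ≤ ∫⁻ x : ℝ, 4 * ‖F (x + a n * I)‖ₑ ^ 2 := by
          refine lintegral_mono fun x => ?_
          have h : ‖((x : ℂ) - w) * ((x : ℂ) + a n * I - w)⁻¹‖ₑ ≤ 2 := by
            rw [← ofReal_norm]
            exact (ENNReal.ofReal_le_ofReal (hratio n x)).trans_eq (by simp)
          simp only [u]
          rw [enorm_mul, mul_pow, mul_comm]
          gcongr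
          exact (pow_le_pow_left' h 2).trans_eq (by norm_num)
      _ = 4 * ∫⁻ x : ℝ, ‖F (x + a n * I)‖ₑ ^ 2 := lintegral_const_mul' _ _ (by simp)
      _ ≤ _ := by
          gcongr
          exact lintegral_line_le F (ha0 n)
  have hconv : ∀ᵐ x : ℝ, Tendsto (fun n => u n x) atTop (𝓝 (f x)) := by
    filter_upwards [hFf] with x hx
    have h1 : Tendsto (fun n => F (x + a n * I)) atTop (𝓝 (f x)) := hx.comp hat'
    have hx0 := ofReal_sub_ne_zero hw'.ne' x
    have h2 : Tendsto (fun n => ((x : ℂ) + a n * I - w)⁻¹) atTop (𝓝 ((x : ℂ) - w)⁻¹) := by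
      refine Tendsto.inv₀ ?_ hx0
      have h3 : Tendsto (fun n => (a n : ℂ)) atTop (𝓝 ((0 : ℝ) : ℂ)) :=
        (Complex.continuous_ofReal.tendsto 0).comp hat
      simpa using (((h3.mul_const I).const_add (x : ℂ)).sub_const w)
    have h4 := h1.mul (h2.const_mul ((x : ℂ) - w))
    rwa [mul_inv_cancel₀ hx0, mul_one] at h4
  have hlim := tendsto_integral_mul_of_bounded hum (ENNReal.mul_lt_top (by simp) hF.bounded) hub hf
    (memLp_inv_sub hw'.ne') hconv
  refine tendsto_nhds_unique hlim (tendsto_const_nhds.congr fun n => ?_)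
  rw [← hF.cauchy_line (ha0 n) (haw n)]
  refine integral_congr_ae (ae_of_all _ fun x => ?_)
  have hx0 := ofReal_sub_ne_zero hw'.ne' x
  simp only [u]
  field_simp

/-! ### Point evaluation on `H²(ℂ₊)`. -/

theorem conj_im_ne_zero {w : ℂ} (hw : w ∈ upperHalf) : (starRingEnd ℂ w).im ≠ 0 := by
  have : 0 < w.im := hw
  simpa using this.ne'

/-- The boundary function `x ↦ 1 / (x - conj w)` as an element of `L²(ℝ)`. -/
def cauchyKernel (w : ℂ) (hw : w ∈ upperHalf) : Lp ℂ 2 (volume : Measure ℝ) :=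
  (memLp_inv_sub (conj_im_ne_zero hw)).toLp _

theorem coeFn_cauchyKernel {w : ℂ} (hw : w ∈ upperHalf) :
    cauchyKernel w hw =ᵐ[volume] fun x : ℝ => ((x : ℂ) - starRingEnd ℂ w)⁻¹ :=
  MemLp.coeFn_toLp _

theorem tendsto_vertical (x : ℝ) :
    Tendsto (fun y : ℝ => (x : ℂ) + y * I) (𝓝[>] 0) (𝓝 (x : ℂ)) := by
  have h : Continuous fun y : ℝ => (x : ℂ) + y * I := by fun_prop
  exact tendsto_nhdsWithin_of_tendsto_nhds (by simpa using h.tendsto 0)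

theorem hasBoundary_inv_sub {v : ℂ} (hv : v.im ≠ 0) :
    HasBoundary (fun z => (z - v)⁻¹) fun x : ℝ => ((x : ℂ) - v)⁻¹ :=
  ae_of_all _ fun x => ((tendsto_vertical x).sub_const v).inv₀ (ofReal_sub_ne_zero hv x)

theorem isExtension_cauchyKernel {w : ℂ} (hw : w ∈ upperHalf) :
    IsExtension (fun z => (z - starRingEnd ℂ w)⁻¹) (cauchyKernel w hw) := by
  have hw' : 0 < w.im := hw
  refine ⟨isHardy_inv_sub (by simpa using hw'), ?_⟩
  filter_upwards [hasBoundary_inv_sub (conj_im_ne_zero hw), coeFn_cauchyKernel hw] with x h1 h2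
  rwa [h2]

theorem inner_cauchyKernel {F : ℂ → ℂ} {f : Lp ℂ 2 (volume : Measure ℝ)} (hF : IsExtension F f)
    {w : ℂ} (hw : w ∈ upperHalf) :
    inner ℂ (cauchyKernel w hw) f = 2 * Real.pi * I * F w := by
  rw [← hF.1.cauchy_boundary (Lp.memLp f) hF.2 hw, L2.inner_def]
  refine integral_congr_ae ?_
  filter_upwards [coeFn_cauchyKernel hw] with x hx
  rw [hx, RCLike.inner_apply]
  simp

/-- The evaluation formula applied to the kernel itself. -/
theorem norm_cauchyKernel {w : ℂ} (hw : w ∈ upperHalf) :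
    ‖cauchyKernel w hw‖ = √(Real.pi / w.im) := by
  have hw' : 0 < w.im := hw
  have h := inner_cauchyKernel (isExtension_cauchyKernel hw) hw
  rw [inner_self_eq_norm_sq_to_K, Complex.sub_conj] at h
  have h2 : (2 * Real.pi * I * ((2 * w.im : ℝ) * I)⁻¹ : ℂ) = ((Real.pi / w.im : ℝ) : ℂ) := by
    have : (w.im : ℂ) ≠ 0 := by exact_mod_cast hw'.ne'
    push_cast
    field_simp [I_ne_zero]
  rw [h2] at h
  have h3 : ‖cauchyKernel w hw‖ ^ 2 = Real.pi / w.im :=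
    Complex.ofReal_injective (by rw [← h, ofReal_pow]; rfl)
  rw [← h3, Real.sqrt_sq (norm_nonneg _)]

theorem norm_eval_le {F : ℂ → ℂ} {f : Lp ℂ 2 (volume : Measure ℝ)} (hF : IsExtension F f)
    {w : ℂ} (hw : w ∈ upperHalf) : 2 * Real.pi * ‖F w‖ ≤ √(Real.pi / w.im) * ‖f‖ := by
  have h := norm_inner_le_norm (𝕜 := ℂ) (cauchyKernel w hw) f
  rw [inner_cauchyKernel hF hw, norm_cauchyKernel] at h
  simpa [abs_of_pos Real.pi_pos] using h

/-! ### Kernels of the model space. -/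

theorem IsInner.exists_boundary {χ : ℂ → ℂ} (hχ : IsInner χ) :
    ∃ b : ℝ → ℂ, AEStronglyMeasurable b volume ∧ HasBoundary χ b ∧ ∀ᵐ x : ℝ, ‖b x‖ = 1 := by
  have h : ∀ x : ℝ, ∃ c : ℂ, (∃ c : ℂ, ‖c‖ = 1 ∧
      Tendsto (fun y : ℝ => χ (x + y * I)) (𝓝[>] 0) (𝓝 c)) →
      ‖c‖ = 1 ∧ Tendsto (fun y : ℝ => χ (x + y * I)) (𝓝[>] 0) (𝓝 c) := fun x => by
    by_cases hx : ∃ c : ℂ, ‖c‖ = 1 ∧ Tendsto (fun y : ℝ => χ (x + y * I)) (𝓝[>] 0) (𝓝 c)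
    · exact hx.imp fun c hc _ => hc
    · exact ⟨0, fun h => absurd h hx⟩
  choose b hb using h
  have hbd : HasBoundary χ b := hχ.boundary.mono fun x hx => (hb x hx).2
  refine ⟨b, ?_, hbd, hχ.boundary.mono fun x hx => (hb x hx).1⟩
  have hseq : Tendsto (fun n : ℕ => 1 / ((n : ℝ) + 1)) atTop (𝓝[>] 0) :=
    tendsto_nhdsWithin_iff.2 ⟨tendsto_one_div_add_atTop_nhds_zero_nat,
      Eventually.of_forall fun n => by simp only [Set.mem_Ioi]; positivity⟩
  refine aestronglyMeasurable_of_tendsto_ae atTop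
    (f := fun (n : ℕ) (x : ℝ) => χ (x + (1 / ((n : ℝ) + 1) : ℝ) * I)) (fun n => ?_)
    (hbd.mono fun x hx => hx.comp hseq)
  exact (measurable_line hχ.analytic (by positivity)).aestronglyMeasurable

/-- The reproducing kernel of `H(χ)` at `w`, up to a constant factor. -/
def modelKernel (χ : ℂ → ℂ) (w : ℂ) (z : ℂ) : ℂ :=
  (1 - starRingEnd ℂ (χ w) * χ z) * (z - starRingEnd ℂ w)⁻¹

theorem norm_one_sub_conj_mul_le {a b : ℂ} (ha : ‖a‖ ≤ 1) (hb : ‖b‖ ≤ 1) :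
    ‖1 - starRingEnd ℂ a * b‖ ≤ 2 := by
  have h := norm_sub_le 1 (starRingEnd ℂ a * b)
  rw [norm_one, norm_mul, RCLike.norm_conj] at h
  nlinarith [norm_nonneg a, norm_nonneg b]

theorem IsInner.norm_modelKernel_le {χ : ℂ → ℂ} (hχ : IsInner χ) {w z : ℂ} (hw : w ∈ upperHalf)
    (hz : z ∈ upperHalf) : ‖modelKernel χ w z‖ ≤ 2 * ‖(z - starRingEnd ℂ w)⁻¹‖ := by
  rw [modelKernel, norm_mul]
  gcongr
  exact norm_one_sub_conj_mul_le (hχ.norm_le_one w hw) (hχ.norm_le_one z hz)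

theorem IsInner.isHardy_modelKernel {χ : ℂ → ℂ} (hχ : IsInner χ) {w : ℂ} (hw : w ∈ upperHalf) :
    IsHardy (modelKernel χ w) := by
  have hK := (isExtension_cauchyKernel hw).1
  refine ⟨((differentiableOn_const 1).sub
    ((differentiableOn_const _).mul hχ.analytic)).mul hK.analytic, ?_⟩
  refine lt_of_le_of_lt (b := 4 * hardyBound fun z => (z - starRingEnd ℂ w)⁻¹)
    (iSup_le fun y => ?_) (ENNReal.mul_lt_top (by simp) hK.bounded)
  have hy : 0 < (y : ℝ) := y.2
  calc ∫⁻ x : ℝ, ‖modelKernel χ w (x + (y : ℝ) * I)‖ₑ ^ 2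
      ≤ ∫⁻ x : ℝ, 4 * ‖((x : ℂ) + (y : ℝ) * I - starRingEnd ℂ w)⁻¹‖ₑ ^ 2 := by
        refine lintegral_mono fun x => ?_
        have h := ENNReal.ofReal_le_ofReal (hχ.norm_modelKernel_le hw
          (z := x + (y : ℝ) * I) (by simpa [upperHalf] using hy))
        rw [ENNReal.ofReal_mul (by norm_num), ofReal_norm, ofReal_norm] at h
        refine (pow_le_pow_left' h 2).trans_eq ?_
        rw [mul_pow]
        norm_num
    _ = 4 * ∫⁻ x : ℝ, ‖((x : ℂ) + (y : ℝ) * I - starRingEnd ℂ w)⁻¹‖ₑ ^ 2 :=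
        lintegral_const_mul' _ _ (by simp)
    _ ≤ _ := by
        gcongr
        exact lintegral_line_le (fun z => (z - starRingEnd ℂ w)⁻¹) hy

/-- Since `|b| = 1` almost everywhere, `f conj(b)` is the boundary function of `G` when `f` is that
of `χ G`. Pairing with the kernel thus gives the Cauchy integral of `χ G` at `w` minus `χ w` times
that of `G`, and these cancel. -/
theorem IsInner.exists_modelKernel {χ : ℂ → ℂ} (hχ : IsInner χ) {w : ℂ} (hw : w ∈ upperHalf) :
    ∃ k : modelSpace χ,
      IsExtension (modelKernel χ w) ((k : hardySpace) : Lp ℂ 2 (volume : Measure ℝ)) ∧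
      ‖(k : hardySpace)‖ ≤ 2 * √(Real.pi / w.im) := by
  obtain ⟨b, hbm, hb, hb1⟩ := hχ.exists_boundary
  have hw' : 0 < w.im := hw
  have hker := memLp_inv_sub (conj_im_ne_zero hw)
  set κ : ℝ → ℂ := fun x => (1 - starRingEnd ℂ (χ w) * b x) * ((x : ℂ) - starRingEnd ℂ w)⁻¹ with hκ
  have hκle : ∀ᵐ x : ℝ, ‖κ x‖ ≤ 2 * ‖((x : ℂ) - starRingEnd ℂ w)⁻¹‖ := by
    filter_upwards [hb1] with x hx
    rw [hκ, norm_mul]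
    gcongr
    exact norm_one_sub_conj_mul_le (hχ.norm_le_one w hw) hx.le
  have hκm : MemLp κ 2 volume :=
    hker.of_le_mul ((aestronglyMeasurable_const.sub (hbm.const_mul _)).mul hker.1) hκle
  have hext : IsExtension (modelKernel χ w) (hκm.toLp κ) := by
    refine ⟨hχ.isHardy_modelKernel hw, ?_⟩
    filter_upwards [hb, hasBoundary_inv_sub (conj_im_ne_zero hw), hκm.coeFn_toLp] with x h1 h2 h3
    rw [h3]
    exact ((h1.const_mul _).const_sub 1).mul h2
  have hmem : (⟨hκm.toLp κ, _, hext⟩ : hardySpace) ∈ modelSpace χ := by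
    refine (Submodule.mem_orthogonal' _ _).2 ?_
    rintro u ⟨G, hG, hGu⟩
    set f : Lp ℂ 2 (volume : Measure ℝ) := u.1 with hf
    change inner ℂ (hκm.toLp κ) f = 0
    set g : ℝ → ℂ := fun x => f x * starRingEnd ℂ (b x) with hg
    have hgm : MemLp g 2 volume := by
      refine (Lp.memLp f).of_le ((Lp.memLp f).1.mul
        (Complex.continuous_conj.comp_aestronglyMeasurable hbm)) ?_
      filter_upwards [hb1] with x hx
      rw [hg, norm_mul, RCLike.norm_conj, hx, mul_one]
    have hGg : HasBoundary G g := by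
      filter_upwards [hGu.2, hb, hb1] with x h1 h2 h3
      have hb0 : b x ≠ 0 := by
        rw [← norm_ne_zero_iff, h3]; exact one_ne_zero
      have h4 : (b x)⁻¹ = starRingEnd ℂ (b x) := by
        rw [Complex.inv_def, Complex.normSq_eq_norm_sq, h3]; simp
      have h5 := h1.mul (h2.inv₀ hb0)
      rw [h4] at h5
      refine h5.congr' ?_
      filter_upwards [h2.eventually_ne hb0] with y hy
      simp only [Pi.mul_apply]
      field_simp
    have hI1 := hGu.1.cauchy_boundary (Lp.memLp f) hGu.2 hw
    have hI2 := hG.cauchy_boundary hgm hGg hw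
    have hwk := memLp_inv_sub hw'.ne'
    rw [L2.inner_def]
    calc ∫ x, inner ℂ (hκm.toLp κ x) (f x)
        = ∫ x : ℝ, (f x * ((x : ℂ) - w)⁻¹ - χ w * (g x * ((x : ℂ) - w)⁻¹)) := by
          refine integral_congr_ae ?_
          filter_upwards [hκm.coeFn_toLp] with x hx
          rw [hx, RCLike.inner_apply]
          simp [hκ, hg]
          ring
      _ = 0 := by
          have hi1 : Integrable fun x : ℝ => f x * ((x : ℂ) - w)⁻¹ :=
            (Lp.memLp f).integrable_mul hwk
          have hi2 : Integrable fun x : ℝ => g x * ((x : ℂ) - w)⁻¹ := hgm.integrable_mul hwk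
          rw [integral_sub hi1 (hi2.const_mul _), integral_const_mul, hI1, hI2]
          simp only [Pi.mul_apply]
          ring
  refine ⟨⟨_, hmem⟩, hext, ?_⟩
  change ‖hκm.toLp κ‖ ≤ _
  rw [← norm_cauchyKernel hw]
  refine Lp.norm_le_mul_norm_of_ae_le_mul ?_
  filter_upwards [hκle, hκm.coeFn_toLp, coeFn_cauchyKernel hw] with x h1 h2 h3
  rwa [h2, h3]

/-! ### Schwarz–Pick growth on the imaginary axis. -/

theorem norm_sub_conj_sq (p q : ℂ) :
    ‖q - starRingEnd ℂ p‖ ^ 2 = ‖q - p‖ ^ 2 + 4 * p.im * q.im := by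
  rw [← Complex.normSq_eq_norm_sq, ← Complex.normSq_eq_norm_sq, Complex.normSq_apply,
    Complex.normSq_apply]
  simp
  ring

theorem cayley_mem_upperHalf {ζ : ℂ} (hζ : ‖ζ‖ < 1) : I * (1 + ζ) / (1 - ζ) ∈ upperHalf := by
  have hne : 1 - ζ ≠ 0 := fun h => by
    rw [← sub_eq_zero.1 h] at hζ
    simp at hζ
  have h1 : ζ.re * ζ.re + ζ.im * ζ.im < 1 := by
    rw [← Complex.normSq_apply, Complex.normSq_eq_norm_sq]
    nlinarith [norm_nonneg ζ]
  have h2 := Complex.normSq_pos.2 hne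
  have h3 : (I * (1 + ζ) / (1 - ζ)).im =
      (1 - (ζ.re * ζ.re + ζ.im * ζ.im)) / Complex.normSq (1 - ζ) := by
    rw [Complex.div_im]
    simp
    field_simp
    ring
  change 0 < (_ : ℂ).im
  rw [h3]
  exact div_pos (by linarith) h2

/-- Growth of an analytic self-map of the half-plane along the imaginary axis. -/
theorem im_map_le {φ : ℂ → ℂ} (hφ : DifferentiableOn ℂ φ upperHalf)
    (hmaps : Set.MapsTo φ upperHalf upperHalf) {t : ℝ} (ht : 1 ≤ t) :
    (φ (t * I)).im ≤ 4 * t * (φ I).im := by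
  have hI : I ∈ upperHalf := by simp [upperHalf]
  have hp : 0 < (φ I).im := hmaps hI
  set p := φ I
  have hden : ∀ q ∈ upperHalf, q - starRingEnd ℂ p ≠ 0 := fun q hq h => by
    have h1 := congrArg Complex.im h
    have h2 : 0 < q.im := hq
    simp at h1
    linarith
  let c : ℂ → ℂ := fun ζ => I * (1 + ζ) / (1 - ζ)
  have hc : Set.MapsTo c (Metric.ball 0 1) upperHalf := fun ζ hζ =>
    cayley_mem_upperHalf (by simpa using hζ)
  have hcd : DifferentiableOn ℂ c (Metric.ball 0 1) := by
    refine DifferentiableOn.div (by fun_prop) (by fun_prop) fun ζ hζ h => ?_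
    rw [← sub_eq_zero.1 h] at hζ
    simp at hζ
  have hφc : DifferentiableOn ℂ (fun ζ => φ (c ζ)) (Metric.ball 0 1) := hφ.comp hcd hc
  have hg : DifferentiableOn ℂ (fun ζ => (φ (c ζ) - p) / (φ (c ζ) - starRingEnd ℂ p))
      (Metric.ball 0 1) :=
    (hφc.sub_const p).div (hφc.sub_const _) fun ζ hζ => hden _ (hmaps (hc hζ))
  have hgm : Set.MapsTo (fun ζ => (φ (c ζ) - p) / (φ (c ζ) - starRingEnd ℂ p))
      (Metric.ball 0 1) (Metric.closedBall 0 1) := fun ζ hζ => by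
    have hq := hmaps (hc hζ)
    have hq' : 0 < (φ (c ζ)).im := hq
    rw [mem_closedBall_zero_iff, norm_div, div_le_one (norm_pos_iff.2 (hden _ hq))]
    refine le_of_sq_le_sq ?_ (norm_nonneg _)
    rw [norm_sub_conj_sq]
    have := mul_pos hp hq'
    linarith
  -- The point `(t - 1) / (t + 1)` of the disc is sent to `t i` by the Cayley map `c`, and `0` is
  -- sent to `i`.
  have hr1 : ‖(((t - 1) / (t + 1) : ℝ) : ℂ)‖ = (t - 1) / (t + 1) := by
    rw [Complex.norm_real, Real.norm_of_nonneg (div_nonneg (by linarith) (by linarith))]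
  have hcr : c (((t - 1) / (t + 1) : ℝ) : ℂ) = t * I := by
    have h1 : (t : ℂ) + 1 ≠ 0 := by exact_mod_cast (by linarith : t + 1 ≠ 0)
    have h2 : (1 : ℂ) - (t - 1) / (t + 1) = 2 / (t + 1) := by field_simp; ring
    simp only [c]
    push_cast
    rw [h2]
    field_simp
    ring
  have hS := norm_le_norm_of_mapsTo_ball hg hgm (by simp [c, p])
    (z := (((t - 1) / (t + 1) : ℝ) : ℂ)) (by
      rw [hr1, div_lt_one (by linarith)]; linarith)
  have hzt : (t : ℂ) * I ∈ upperHalf := by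
    simp [upperHalf]; linarith
  have hq := hmaps hzt
  have hs : 0 < (φ (t * I)).im := hq
  simp only [hcr] at hS
  rw [hr1, norm_div, div_le_div_iff₀ (norm_pos_iff.2 (hden _ hq)) (by linarith)] at hS
  set q := φ (t * I)
  have hN := norm_sub_conj_sq p q
  have him : q.im ≤ ‖q - starRingEnd ℂ p‖ := by
    have := (le_abs_self _).trans (Complex.abs_im_le_norm (q - starRingEnd ℂ p))
    simp at this
    linarith
  set N := ‖q - starRingEnd ℂ p‖
  have h1 : ‖q - p‖ ^ 2 * (t + 1) ^ 2 ≤ (t - 1) ^ 2 * N ^ 2 := by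
    rw [← mul_pow, ← mul_pow]
    exact pow_le_pow_left₀ (mul_nonneg (norm_nonneg _) (by linarith)) hS 2
  -- Uses `N² - |q - p|² = 4 Im p Im q` and `(t + 1)² - (t - 1)² = 4 t`.
  have h2 : t * N ^ 2 ≤ p.im * q.im * (t + 1) ^ 2 := by nlinarith
  have h3 : (t + 1) ^ 2 ≤ 4 * t ^ 2 := by nlinarith
  have h4 : q.im ^ 2 ≤ N ^ 2 := pow_le_pow_left₀ hs.le him 2
  have h5 : t * q.im ^ 2 ≤ p.im * q.im * (4 * t ^ 2) :=
    (mul_le_mul_of_nonneg_left h4 (by linarith)).trans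
      (h2.trans (mul_le_mul_of_nonneg_left h3 (mul_pos hp hs).le))
  refine le_of_mul_le_mul_left (a := t * q.im) ?_ (mul_pos (by linarith) hs)
  nlinarith

/-! ### Bounded and compact operators on a subspace. -/

theorem exists_bound_on_submodule {H : Type*} [NormedAddCommGroup H] [NormedSpace ℂ H]
    (p : Submodule ℂ H) (T : p →L[ℂ] H) : ∃ M : ℝ, 0 ≤ M ∧ ∀ f : p, ‖T f‖ ≤ M * ‖(f : H)‖ :=
  ⟨‖T‖, norm_nonneg T, T.le_opNorm⟩

theorem exists_tendsto_subseq_of_isCompactOperator {H : Type*} [NormedAddCommGroup H]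
    [NormedSpace ℂ H] (p : Submodule ℂ H) (T : p →L[ℂ] H) (hT : IsCompactOperator T) {f : ℕ → p}
    {M : ℝ} (hf : ∀ n, ‖(f n : H)‖ ≤ M) :
    ∃ (g : H) (ψ : ℕ → ℕ), StrictMono ψ ∧ Tendsto (fun n => T (f (ψ n))) atTop (𝓝 g) := by
  obtain ⟨K, hK, hKsub⟩ := IsCompactOperator.image_closedBall_subset_compact
    (f := (T : p →ₗ[ℂ] H)) hT M
  obtain ⟨g, -, ψ, hψ, hg⟩ := hK.tendsto_subseq (x := fun n => T (f n))
    fun n => hKsub ⟨f n, by simpa using hf n, rfl⟩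
  exact ⟨g, ψ, hψ, hg⟩

end HalfPlane

end

/-! ### The contradiction with compactness. -/

theorem theorem3p2 (χ φ : ℂ → ℂ)
    (hχ : HalfPlane.IsInner χ)
    (hχ_nonconst : ¬ ∃ c : ℂ, ∀ z ∈ HalfPlane.upperHalf, χ z = c)
    (hφ : DifferentiableOn ℂ φ HalfPlane.upperHalf)
    (hφ_maps : Set.MapsTo φ HalfPlane.upperHalf HalfPlane.upperHalf)
    (hsup : (⨆ z : HalfPlane.upperHalf, ‖χ (φ z)‖) < 1)
    (T : HalfPlane.modelSpace χ →L[ℂ] HalfPlane.hardySpace)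
    (hT : HalfPlane.IsCompositionOperator χ φ T) :
    ¬ IsCompactOperator T := by
  intro hcomp
  set δ := ⨆ z : HalfPlane.upperHalf, ‖χ (φ z)‖ with hδ
  have hle : ∀ z ∈ HalfPlane.upperHalf, ‖χ (φ z)‖ ≤ δ := fun z hz =>
    le_ciSup (f := fun z : HalfPlane.upperHalf => ‖χ (φ z)‖)
      ⟨1, by rintro _ ⟨z, rfl⟩; exact hχ.norm_le_one _ (hφ_maps z.2)⟩ ⟨z, hz⟩
  have hI : I ∈ HalfPlane.upperHalf := by simp [HalfPlane.upperHalf]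
  have hδ0 : 0 ≤ δ := (norm_nonneg _).trans (hle I hI)
  set d : ℝ := 1 - δ ^ 2 with hd
  have hd0 : 0 < d := by nlinarith
  have hp : 0 < (φ I).im := hφ_maps hI
  have hπ := Real.pi_pos
  -- The shift by one gives `t n ≥ 1`, as `im_map_le` requires.
  let t : ℕ → ℝ := fun n => n + 1
  have ht1 : ∀ n, 1 ≤ t n := fun n => by simp [t]
  have ht0 : ∀ n, 0 < t n := fun n => one_pos.trans_le (ht1 n)
  have hz : ∀ n, (t n : ℂ) * I ∈ HalfPlane.upperHalf := fun n => by
    simpa [HalfPlane.upperHalf] using ht0 n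
  let w : ℕ → ℂ := fun n => φ (t n * I)
  have hw : ∀ n, w n ∈ HalfPlane.upperHalf := fun n => hφ_maps (hz n)
  have hs0 : ∀ n, 0 < (w n).im := hw
  choose k hkext hknorm using fun n => hχ.exists_modelKernel (hw n)
  have hdiag : ∀ n, d / (2 * (w n).im) ≤ ‖HalfPlane.modelKernel χ (w n) (w n)‖ := fun n => by
    have h1 : ‖χ (w n)‖ ≤ δ := hle _ (hz n)
    have h2 : ‖χ (w n)‖ ^ 2 ≤ δ ^ 2 := pow_le_pow_left₀ (norm_nonneg _) h1 2
    have h3 : (1 : ℂ) - starRingEnd ℂ (χ (w n)) * χ (w n) = ((1 - ‖χ (w n)‖ ^ 2 : ℝ) : ℂ) := by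
      rw [Complex.conj_mul']; push_cast; rfl
    rw [HalfPlane.modelKernel, h3, Complex.sub_conj, norm_mul, norm_inv, norm_mul, norm_I,
      Complex.norm_real, Complex.norm_real, mul_one, ← div_eq_mul_inv,
      Real.norm_of_nonneg (by nlinarith), Real.norm_of_nonneg (by linarith [hs0 n])]
    have := hs0 n
    gcongr
    linarith
  have hlower : ∀ n, Real.pi * d / (w n).im ≤ √(Real.pi / t n) * ‖T (k n)‖ := fun n => by
    have h1 := HalfPlane.norm_eval_le (hT (k n) _ (hkext n)) (hz n)
    have him : ((t n : ℂ) * I).im = t n := by simp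
    rw [him] at h1
    have h2 := mul_le_mul_of_nonneg_left (hdiag n) (by positivity : 0 ≤ 2 * Real.pi)
    refine le_trans (le_of_eq ?_) (h2.trans h1)
    have := (hs0 n).ne'
    field_simp
  obtain ⟨M, hM0, hM⟩ := HalfPlane.exists_bound_on_submodule (HalfPlane.modelSpace χ) T
  -- The constant comes from squaring `π d / Im w ≤ √(π / t) · 2 M √(π / Im w)` and solving for `t`.
  set c : ℝ := 4 * M ^ 2 / d ^ 2 with hc
  have hc0 : 0 ≤ c := by positivity
  have hts : ∀ n, t n ≤ c * (w n).im := fun n => by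
    have hs := hs0 n
    have ht := ht0 n
    have h1 : ‖T (k n)‖ ≤ M * (2 * √(Real.pi / (w n).im)) :=
      (hM (k n)).trans (mul_le_mul_of_nonneg_left (hknorm n) hM0)
    have h2 := (hlower n).trans (mul_le_mul_of_nonneg_left h1 (Real.sqrt_nonneg _))
    have h3 := pow_le_pow_left₀ (by positivity) h2 2
    rw [mul_pow, mul_pow, mul_pow, Real.sq_sqrt (by positivity), Real.sq_sqrt (by positivity),
      div_pow] at h3
    rw [hc]
    rw [div_mul_eq_mul_div, le_div_iff₀ (by positivity)]
    field_simp at h3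
    linarith
  let f : ℕ → HalfPlane.modelSpace χ := fun n => ((√(t n) : ℝ) : ℂ) • k n
  have hfnorm : ∀ n, ‖(f n : HalfPlane.hardySpace)‖ ≤ 2 * √(Real.pi * c) := fun n => by
    have hs := hs0 n
    simp only [f]
    rw [Submodule.coe_smul, norm_smul, Complex.norm_real, Real.norm_of_nonneg (Real.sqrt_nonneg _)]
    calc √(t n) * ‖(k n : HalfPlane.hardySpace)‖ ≤ √(t n) * (2 * √(Real.pi / (w n).im)) := by
          gcongr; exact hknorm n
      _ = 2 * √(t n * (Real.pi / (w n).im)) := by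
          rw [Real.sqrt_mul (ht0 n).le]; ring
      _ ≤ 2 * √(Real.pi * c) := by
          refine mul_le_mul_of_nonneg_left (Real.sqrt_le_sqrt ?_) zero_le_two
          rw [mul_div_assoc', div_le_iff₀ hs]
          have := mul_le_mul_of_nonneg_left (hts n) hπ.le
          linarith
  -- This is the lower bound `√π d t / Im w` for `‖T (f n)‖` after inserting `Im w ≤ 4 t Im φ(i)`.
  set η : ℝ := √Real.pi * d / (4 * (φ I).im) with hη
  have hη0 : 0 < η := by positivity
  have hTf : ∀ n, η ≤ ‖T (f n)‖ := fun n => by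
    have hs := hs0 n
    have ht := ht0 n
    have h1 : ‖T (f n)‖ = √(t n) * ‖T (k n)‖ := by
      simp only [f]
      rw [map_smul, norm_smul, Complex.norm_real, Real.norm_of_nonneg (Real.sqrt_nonneg _)]
    have h2 : (w n).im ≤ 4 * t n * (φ I).im := HalfPlane.im_map_le hφ hφ_maps (ht1 n)
    have h3 := hlower n
    rw [Real.sqrt_div hπ.le] at h3
    have hst := Real.sqrt_pos.2 ht
    have hsπ := Real.sqrt_pos.2 hπ
    have h4 : √Real.pi * √Real.pi = Real.pi := Real.mul_self_sqrt hπ.le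
    have h5 : √(t n) * √(t n) = t n := Real.mul_self_sqrt ht.le
    have h6 : √Real.pi * d * t n / (w n).im ≤ √(t n) * ‖T (k n)‖ := by
      have h7 := mul_le_mul_of_nonneg_left h3 (by positivity : 0 ≤ t n / √Real.pi)
      refine le_trans (le_of_eq ?_) (h7.trans (le_of_eq ?_))
      · field_simp
        rw [pow_two, h4]
      · field_simp
        rw [pow_two, h5]
    rw [h1]
    refine le_trans ?_ h6
    rw [hη, div_le_div_iff₀ (by positivity) hs]
    have := mul_le_mul_of_nonneg_left h2 (by positivity : 0 ≤ √Real.pi * d)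
    linarith
  obtain ⟨g, ψ, hψ, hg⟩ := HalfPlane.exists_tendsto_subseq_of_isCompactOperator
    (HalfPlane.modelSpace χ) T hcomp hfnorm
  have hgη : η ≤ ‖g‖ := ge_of_tendsto hg.norm (Eventually.of_forall fun n => hTf (ψ n))
  obtain ⟨G, hG⟩ := g.2
  have hfext : ∀ n, HalfPlane.IsExtension (((√(t n) : ℝ) : ℂ) • HalfPlane.modelKernel χ (w n))
      ((f n : HalfPlane.hardySpace) : Lp ℂ 2 (volume : Measure ℝ)) := fun n => (hkext n).smul _
  -- Norm convergence implies pointwise convergence, by pairing with the Cauchy kernel at `z`. At `φ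
  -- z` the function of `f n` is at most `2 √(t n) / Im w n ≤ 2 c / √(t n)`.
  have hGzero : ∀ z ∈ HalfPlane.upperHalf, G z = 0 := by
    intro z hzu
    have h1 : Tendsto (fun n => inner ℂ (HalfPlane.cauchyKernel z hzu)
        (T (f (ψ n)) : Lp ℂ 2 (volume : Measure ℝ))) atTop
        (𝓝 (inner ℂ (HalfPlane.cauchyKernel z hzu) (g : Lp ℂ 2 (volume : Measure ℝ)))) :=
      tendsto_const_nhds.inner ((continuous_subtype_val.tendsto g).comp hg)
    rw [HalfPlane.inner_cauchyKernel hG hzu] at h1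
    have h2 : Tendsto (fun n => inner ℂ (HalfPlane.cauchyKernel z hzu)
        (T (f n) : Lp ℂ 2 (volume : Measure ℝ))) atTop (𝓝 0) := by
      have hlim : Tendsto (fun n => 2 * Real.pi * (2 * c / √(t n))) atTop (𝓝 0) := by
        have : Tendsto t atTop atTop :=
          tendsto_atTop_add_const_right _ _ tendsto_natCast_atTop_atTop
        simpa using ((Real.tendsto_sqrt_atTop.comp this).const_div_atTop (2 * c)).const_mul
          (2 * Real.pi)
      refine squeeze_zero_norm (fun n => ?_) hlim
      have hs := hs0 n
      have hst := Real.sqrt_pos.2 (ht0 n)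
      have hφz : 0 < (φ z).im := hφ_maps hzu
      rw [HalfPlane.inner_cauchyKernel (hT (f n) _ (hfext n)) hzu]
      simp only [Function.comp_apply, Pi.smul_apply, norm_mul, smul_eq_mul, norm_I,
        Complex.norm_real, Complex.norm_ofNat, mul_one, Real.norm_of_nonneg hπ.le,
        Real.norm_of_nonneg hst.le]
      gcongr
      have h3 := hχ.norm_modelKernel_le (hw n) (hφ_maps hzu)
      have h4 : (w n).im ≤ ‖φ z - starRingEnd ℂ (w n)‖ := by
        have := (le_abs_self _).trans (Complex.abs_im_le_norm (φ z - starRingEnd ℂ (w n)))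
        simp at this
        linarith
      have h5 : ‖(φ z - starRingEnd ℂ (w n))⁻¹‖ ≤ c / t n := by
        rw [norm_inv, inv_eq_one_div, div_le_div_iff₀ (hs.trans_le h4) (ht0 n)]
        have := mul_le_mul_of_nonneg_left h4 hc0
        linarith [hts n]
      calc √(t n) * ‖HalfPlane.modelKernel χ (w n) (φ z)‖ ≤ √(t n) * (2 * (c / t n)) := by
            gcongr
            linarith
        _ = 2 * c / √(t n) := by
            have h6 : √(t n) * √(t n) = t n := Real.mul_self_sqrt (ht0 n).le
            have := (ht0 n).ne'
            field_simp
            rw [pow_two, h6, mul_comm]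
    have h3 := tendsto_nhds_unique h1 (h2.comp hψ.tendsto_atTop)
    simpa [hπ.ne'] using h3
  have hg0 : (g : Lp ℂ 2 (volume : Measure ℝ)) = 0 := by
    rw [Lp.eq_zero_iff_ae_eq_zero]
    filter_upwards [hG.2] with x hx
    refine tendsto_nhds_unique hx (tendsto_const_nhds.congr' ?_)
    filter_upwards [self_mem_nhdsWithin] with y hy
    exact (hGzero _ (by simpa [HalfPlane.upperHalf] using hy)).symm
  have hgn : ‖g‖ = 0 := by
    change ‖(g : Lp ℂ 2 (volume : Measure ℝ))‖ = 0
    rw [hg0, norm_zero]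
  linarith
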